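/- For a simple graph $G$ with vertex set $[m]=\{1,\dots,m\}$, let $S(G)$ be the set of real symmetric $m\times m$ matrices $A=(a(i,j))$ such that, for $i\ne j$, $a(i,j)\neq 0$ if and only if $\{i,j\}$ is an edge of $G$ (the diagonal entries are unrestricted). A real symmetric $m\times m$ matrix $A$ has the strong spectral property (SSP) if $X=0$ is the only real symmetric $m\times m$ matrix with $AX=XA$ and $A\circ X=I_m\circ X=0$, where $\circ$ is the entrywise product. A vector is nowhere-zero if each of its entries is nonzero. Theorem. Let $G$ be a connected simple graph of order $m\ge 1$ with vertex set $[m]$, let $\lambda_1<\lambda_2<\dots<\lambda_m$ be real numbers, put $\Lambda=\operatorname{diag}(\lambda_1,\dots,\lambda_m)$, and let $\mathcal Y\subset\mathbb R^m\setminus\{\mathbf 0\}$ be a finite set. Then there exist a matrix $A\in S(G)$ with eigenvalues $\lambda_1,\dots,\lambda_m$ and with the SSP, and an orthogonal $m\times m$ real matrix $U$ with $U^\top A U=\Lambda$, such that $U\mathbf v$ is nowhere-zero for every $\mathbf v\in\mathcal Y$. -/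

import Mathlib

open scoped Matrix

namespace GenericRealisability

/-- `S(G)`: the real symmetric matrices whose off-diagonal `(i, j)` entry is nonzero exactly when
`{i, j}` is an edge of `G`; the diagonal entries are unrestricted. -/
def S {m : ℕ} (G : SimpleGraph (Fin m)) : Set (Matrix (Fin m) (Fin m) ℝ) :=
  {A | A.IsSymm ∧ ∀ i j, i ≠ j → (A i j ≠ 0 ↔ G.Adj i j)}

/-- `ℰ_Λ` for `Λ = diag(lam)`: the real symmetric matrices whose eigenvalues, counted with
multiplicity, are the `lam i`. -/
def isospectral {m : ℕ} (lam : Fin m → ℝ) : Set (Matrix (Fin m) (Fin m) ℝ) :=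
  {A | A.IsSymm ∧ A.charpoly.roots = Finset.univ.val.map lam}

/-- The strong spectral property: `A` is symmetric, and `X = 0` is the only symmetric matrix with
`A * X = X * A` and `A ⊙ X = 1 ⊙ X = 0`, where `⊙` is the entrywise (Hadamard) product. -/
def SSP {m : ℕ} (A : Matrix (Fin m) (Fin m) ℝ) : Prop :=
  A.IsSymm ∧ ∀ X : Matrix (Fin m) (Fin m) ℝ,
    X.IsSymm → A * X = X * A → A ⊙ X = 0 → (1 : Matrix (Fin m) (Fin m) ℝ) ⊙ X = 0 → X = 0

/-- Every entry of the vector is nonzero. -/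
def NowhereZero {m : ℕ} (v : Fin m → ℝ) : Prop := ∀ i, v i ≠ 0

end GenericRealisability

namespace GenericRealisability

open Filter Topology
open scoped ContDiff Matrix.Norms.Operator

/-! Perturb `diag lam`. Since the eigenvalues are distinct, the inverse function theorem gives an
orthogonal `U T`, analytic in `T` near 0 with `U 0 = 1`, such that the conjugate of `diag lam` by `U
T` has the entries of `T` above the diagonal (`exists_analyticAt_orthogonal`). Feed it only matrices
supported on the edges of `G`. Nonvanishing of every edge entry and of every coordinate of every `U
*ᵥ v` is then a finite list of conditions on analytic germs. A product of nonzero germs is nonzero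
(`frequently_mul_ne_zero`), so each condition may be tested alone, with its own direction. For
coordinate `i` of `U *ᵥ v` the direction is a shortest path from `i` to the support of `v`: there
the matrix is a Jacobi block plus a diagonal, and eigenvectors of a Jacobi matrix have nonzero first
entry (`mulVec_ne_zero_of_path`). The SSP follows from `det (U ⊙ U) ≠ 0`, which holds near `U = 1`.
-/

/-! ### Analytic orthogonal diagonalization near `diag lam`. -/

/-- The linear projection keeping the entries of a matrix strictly above the diagonal. -/
noncomputable def strictUpper (m : ℕ) :
    Matrix (Fin m) (Fin m) ℝ →L[ℝ] Matrix (Fin m) (Fin m) ℝ :=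
  LinearMap.toContinuousLinearMap
    { toFun := fun K => Matrix.of fun i j => if i < j then K i j else 0
      map_add' := fun K L => by ext i j; by_cases h : i < j <;> simp [h]
      map_smul' := fun c K => by ext i j; by_cases h : i < j <;> simp [h] }

lemma strictUpper_apply {m : ℕ} (K : Matrix (Fin m) (Fin m) ℝ) (i j : Fin m) :
    strictUpper m K i j = if i < j then K i j else 0 := rfl

/-- The linear map `K ↦ K - Kᵀ` onto the skew-symmetric matrices. -/
noncomputable def skewPart (m : ℕ) :
    Matrix (Fin m) (Fin m) ℝ →L[ℝ] Matrix (Fin m) (Fin m) ℝ :=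
  LinearMap.toContinuousLinearMap
    { toFun := fun K => K - Kᵀ
      map_add' := fun K L => by simp; abel
      map_smul' := fun c K => by simp [smul_sub] }

lemma skewPart_apply {m : ℕ} (K : Matrix (Fin m) (Fin m) ℝ) : skewPart m K = K - Kᵀ := rfl

lemma exp_skewPart_mem_orthogonalGroup {m : ℕ} (K : Matrix (Fin m) (Fin m) ℝ) :
    NormedSpace.exp (skewPart m K) ∈ Matrix.orthogonalGroup (Fin m) ℝ := by
  rw [Matrix.mem_orthogonalGroup_iff, ← Matrix.exp_transpose]
  have h : (skewPart m K)ᵀ = -skewPart m K := by simp [skewPart_apply]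
  rw [h, ← Matrix.exp_add_of_commute _ _ (Commute.refl (skewPart m K)).neg_right]
  simp

/-- Conjugating `diag lam` by the exponential of a skew-symmetric matrix, recorded above the
diagonal; the remaining entries of the argument are kept. -/
noncomputable def conjChart {m : ℕ} (lam : Fin m → ℝ) (K : Matrix (Fin m) (Fin m) ℝ) :
    Matrix (Fin m) (Fin m) ℝ :=
  strictUpper m (NormedSpace.exp (skewPart m K) * Matrix.diagonal lam *
    NormedSpace.exp (-skewPart m K)) + (K - strictUpper m K)

lemma contDiff_exp {m : ℕ} :
    ContDiff ℝ ω (NormedSpace.exp : Matrix (Fin m) (Fin m) ℝ → Matrix (Fin m) (Fin m) ℝ) :=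
  contDiff_iff_contDiffAt.2 fun x => (NormedSpace.exp_analytic (𝕂 := ℝ) x).contDiffAt

lemma contDiff_conjChart {m : ℕ} (lam : Fin m → ℝ) : ContDiff ℝ ω (conjChart lam) := by
  have h1 : ContDiff ℝ ω fun K : Matrix (Fin m) (Fin m) ℝ => NormedSpace.exp (skewPart m K) :=
    contDiff_exp.comp (skewPart m).contDiff
  have h2 : ContDiff ℝ ω fun K : Matrix (Fin m) (Fin m) ℝ => NormedSpace.exp (-skewPart m K) :=
    contDiff_exp.comp (skewPart m).contDiff.neg
  exact ((strictUpper m).contDiff.comp ((h1.mul contDiff_const).mul h2)).add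
    (contDiff_id.sub (strictUpper m).contDiff)

/-- The derivative of `conjChart lam` at `0`. -/
noncomputable def conjChartDeriv {m : ℕ} (lam : Fin m → ℝ) :
    Matrix (Fin m) (Fin m) ℝ →ₗ[ℝ] Matrix (Fin m) (Fin m) ℝ where
  toFun K := strictUpper m (skewPart m K * Matrix.diagonal lam - Matrix.diagonal lam * skewPart m K)
    + (K - strictUpper m K)
  map_add' K L := by simp only [map_add, add_mul, mul_add, map_sub]; abel
  map_smul' c K := by simp [smul_sub]

lemma conjChartDeriv_apply {m : ℕ} (lam : Fin m → ℝ) (K : Matrix (Fin m) (Fin m) ℝ)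
    (i j : Fin m) : conjChartDeriv lam K i j =
      if i < j then (K i j - K j i) * (lam j - lam i) else K i j := by
  change strictUpper m _ i j + (K i j - strictUpper m K i j) = _
  by_cases h : i < j
  · simp only [strictUpper_apply, h, if_true, Matrix.sub_apply, Matrix.mul_diagonal,
      Matrix.diagonal_mul, skewPart_apply, Matrix.transpose_apply]
    ring
  · simp [strictUpper_apply, h]

/-- On and below the diagonal the derivative is the identity, so a kernel element vanishes there;
above it, what remains is multiplication by the nonzero gaps `lam j - lam i`. -/
lemma conjChartDeriv_injective {m : ℕ} {lam : Fin m → ℝ} (hlam : Function.Injective lam) :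
    Function.Injective (conjChartDeriv lam) := by
  rw [← LinearMap.ker_eq_bot, LinearMap.ker_eq_bot']
  intro K hK
  have hK' : ∀ i j, (if i < j then (K i j - K j i) * (lam j - lam i) else K i j) = 0 :=
    fun i j => by rw [← conjChartDeriv_apply, hK]; rfl
  have hle : ∀ i j, ¬ i < j → K i j = 0 := fun i j h => by simpa [h] using hK' i j
  ext i j
  by_cases h : i < j
  · have := hK' i j
    rw [if_pos h, hle j i h.not_gt, sub_zero] at this
    exact (mul_eq_zero.1 this).resolve_right (sub_ne_zero.2 fun e => h.ne (hlam e).symm)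
  · exact hle i j h

lemma hasFDerivAt_exp_mul_mul_exp_neg {E A : Type*} [NormedAddCommGroup E] [NormedSpace ℝ E]
    [NormedRing A] [NormedAlgebra ℝ A] [CompleteSpace A] (f : E →L[ℝ] A) (a : A) :
    HasFDerivAt (fun x => NormedSpace.exp (f x) * a * NormedSpace.exp (-f x))
      (((ContinuousLinearMap.mul ℝ A).flip a - ContinuousLinearMap.mul ℝ A a).comp f) 0 := by
  have e0 : HasFDerivAt (NormedSpace.exp : A → A) (1 : A →L[ℝ] A) 0 := hasFDerivAt_exp_zero
  have h1 : HasFDerivAt (fun x => NormedSpace.exp (f x)) f 0 :=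
    (HasFDerivAt.comp (0 : E) (by simpa using e0) f.hasFDerivAt).congr_fderiv (by ext; simp)
  have h2 : HasFDerivAt (fun x => NormedSpace.exp (-f x)) (-f) 0 :=
    (HasFDerivAt.comp (0 : E) (by simpa using e0) f.hasFDerivAt.neg).congr_fderiv (by ext; simp)
  refine ((h1.mul_const' a).mul' h2).congr_fderiv ?_
  ext x
  simp
  abel

lemma hasFDerivAt_conjChart {m : ℕ} (lam : Fin m → ℝ) :
    HasFDerivAt (conjChart lam) (LinearMap.toContinuousLinearMap (conjChartDeriv lam)) 0 := by
  have h := ((strictUpper m).hasFDerivAt.comp (0 : Matrix (Fin m) (Fin m) ℝ)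
    (hasFDerivAt_exp_mul_mul_exp_neg (skewPart m) (Matrix.diagonal lam))).add
      ((hasFDerivAt_id (𝕜 := ℝ) (0 : Matrix (Fin m) (Fin m) ℝ)).sub (strictUpper m).hasFDerivAt)
  refine h.congr_fderiv ?_
  ext1 K
  rfl

/-- Near `0`, the strictly upper triangular entries of a symmetric matrix with simple spectrum
`lam` can be prescribed freely, with an orthogonal diagonalizing matrix depending analytically
on them. -/
theorem exists_analyticAt_orthogonal {m : ℕ} {lam : Fin m → ℝ} (hlam : Function.Injective lam) :
    ∃ U : Matrix (Fin m) (Fin m) ℝ → Matrix (Fin m) (Fin m) ℝ, AnalyticAt ℝ U 0 ∧ U 0 = 1 ∧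
      (∀ T, U T ∈ Matrix.orthogonalGroup (Fin m) ℝ) ∧
      ∀ᶠ T in 𝓝 0, ∀ i j, i < j → (U T * Matrix.diagonal lam * (U T)ᵀ) i j = T i j := by
  let e := (LinearEquiv.ofInjectiveEndo (conjChartDeriv lam)
    (conjChartDeriv_injective hlam)).toContinuousLinearEquiv
  have hd : HasFDerivAt (conjChart lam) (e : Matrix (Fin m) (Fin m) ℝ →L[ℝ] _) 0 :=
    (hasFDerivAt_conjChart lam).congr_fderiv (by ext1 K; rfl)
  have hc : ContDiffAt ℝ ω (conjChart lam) 0 := (contDiff_conjChart lam).contDiffAt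
  have h0 : conjChart lam 0 = 0 := by
    ext i j
    by_cases h : i < j <;> simp [conjChart, strictUpper_apply, h]
    simp [h.ne]
  have hs := hc.hasStrictFDerivAt' hd (by simp)
  -- Smoothness of order `ω` passes to the local inverse, which is therefore analytic.
  have hg := hc.to_localInverse hd (by simp)
  have hg0 := hc.localInverse_apply_image hd (by simp)
  have hr := hs.eventually_right_inverse
  rw [h0] at hg hg0 hr
  set g := hc.localInverse hd (by simp) with hgdef
  refine ⟨fun T => NormedSpace.exp (skewPart m (g T)), ?_, ?_, ?_, ?_⟩
  · exact ((contDiff_exp.comp (skewPart m).contDiff).contDiffAt.comp _ hg).analyticAt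
  · simp [hg0]
  · exact fun T => exp_skewPart_mem_orthogonalGroup _
  · filter_upwards [hr] with T hT i j hij
    have hT' : conjChart lam (g T) = T := hT
    have h := congrFun (congrFun hT' i) j
    have ht : (skewPart m (g T))ᵀ = -skewPart m (g T) := by simp [skewPart_apply]
    rw [← Matrix.exp_transpose, ht]
    simpa [conjChart, strictUpper_apply, hij] using h

/-! ### Nonzero analytic germs. -/

/-- `∃ᶠ` says that the germ is nonzero. If the product vanished on a ball, `g` would vanish around a
point where `f ≠ 0`, hence on the whole ball by the identity theorem. -/
lemma frequently_mul_ne_zero {E : Type*} [NormedAddCommGroup E] [NormedSpace ℝ E] {f g : E → ℝ}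
    {x : E} (hf : AnalyticAt ℝ f x) (hg : AnalyticAt ℝ g x) (hf0 : ∃ᶠ y in 𝓝 x, f y ≠ 0)
    (hg0 : ∃ᶠ y in 𝓝 x, g y ≠ 0) : ∃ᶠ y in 𝓝 x, f y * g y ≠ 0 := by
  intro h
  simp only [ne_eq, not_not] at h
  obtain ⟨r, hr, hball⟩ := Metric.eventually_nhds_iff_ball.1
    ((hf.eventually_analyticAt.and hg.eventually_analyticAt).and h)
  obtain ⟨y, hy, hyr⟩ := (hf0.and_eventually (Metric.ball_mem_nhds x hr)).exists
  have hfy : ∀ᶠ z in 𝓝 y, f z ≠ 0 :=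
    (hball y hyr).1.1.continuousAt.eventually_ne hy
  have hgy : g =ᶠ[𝓝 y] 0 := by
    filter_upwards [hfy, Metric.isOpen_ball.mem_nhds hyr] with z hz hzr
    exact (mul_eq_zero.1 (hball z hzr).2).resolve_left hz
  have hgan : AnalyticOnNhd ℝ g (Metric.ball x r) := fun z hz => (hball z hz).1.2
  have := hgan.eqOn_zero_of_preconnected_of_eventuallyEq_zero
    (convex_ball x r).isPreconnected hyr hgy
  refine hg0 ?_
  filter_upwards [Metric.ball_mem_nhds x hr] with z hz
  simpa using this hz

lemma frequently_prod_ne_zero {E ι : Type*} [NormedAddCommGroup E] [NormedSpace ℝ E]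
    {f : ι → E → ℝ} {x : E} (s : Finset ι) (hf : ∀ i ∈ s, AnalyticAt ℝ (f i) x)
    (hf0 : ∀ i ∈ s, ∃ᶠ y in 𝓝 x, f i y ≠ 0) : ∃ᶠ y in 𝓝 x, ∏ i ∈ s, f i y ≠ 0 := by
  classical
  induction s using Finset.induction_on with
  | empty => simp
  | insert i s hi ih =>
    simp only [Finset.prod_insert hi]
    have hs : AnalyticAt ℝ (fun y => ∏ j ∈ s, f j y) x :=
      s.analyticAt_fun_prod fun j hj => hf j (Finset.mem_insert_of_mem hj)
    exact frequently_mul_ne_zero (hf i (Finset.mem_insert_self i s)) hs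
      (hf0 i (Finset.mem_insert_self i s))
      (ih (fun j hj => hf j (Finset.mem_insert_of_mem hj))
        fun j hj => hf0 j (Finset.mem_insert_of_mem hj))

/-! ### SSP and spectrum of the conjugate. -/

/-- A matrix with simple spectrum has the SSP as soon as the entrywise square of an orthogonal
diagonalizing matrix is nonsingular. -/
lemma SSP_of_det_sq_ne_zero {m : ℕ} {lam : Fin m → ℝ} (hlam : Function.Injective lam)
    {U : Matrix (Fin m) (Fin m) ℝ} (hU : U ∈ Matrix.orthogonalGroup (Fin m) ℝ)
    (hdet : (U ⊙ U).det ≠ 0) : SSP (U * Matrix.diagonal lam * Uᵀ) := by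
  have h1 : Uᵀ * U = 1 := (Matrix.mem_orthogonalGroup_iff' _ _).1 hU
  have h2 : U * Uᵀ = 1 := (Matrix.mem_orthogonalGroup_iff _ _).1 hU
  refine ⟨by simp [Matrix.IsSymm, Matrix.mul_assoc], fun X _ hcomm _ hdiag => ?_⟩
  set D := Uᵀ * X * U with hD
  have hX : X = U * D * Uᵀ := by
    rw [hD]
    simp only [Matrix.mul_assoc, h2, Matrix.mul_one]
    rw [← Matrix.mul_assoc, h2, Matrix.one_mul]
  have hDcomm : Matrix.diagonal lam * D = D * Matrix.diagonal lam := by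
    have : Uᵀ * (U * Matrix.diagonal lam * Uᵀ * X) * U =
        Uᵀ * (X * (U * Matrix.diagonal lam * Uᵀ)) * U := by rw [hcomm]
    calc Matrix.diagonal lam * D = (Uᵀ * U) * Matrix.diagonal lam * (Uᵀ * X * U) := by
          rw [h1, Matrix.one_mul]
      _ = Uᵀ * (U * Matrix.diagonal lam * Uᵀ * X) * U := by simp only [Matrix.mul_assoc]
      _ = (Uᵀ * X * U) * Matrix.diagonal lam * (Uᵀ * U) := by
          rw [this]; simp only [Matrix.mul_assoc]
      _ = D * Matrix.diagonal lam := by rw [h1, Matrix.mul_one]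
  have hoff : ∀ i j, i ≠ j → D i j = 0 := by
    intro i j hij
    have h := congrFun (congrFun hDcomm i) j
    rw [Matrix.diagonal_mul, Matrix.mul_diagonal] at h
    have : (lam i - lam j) * D i j = 0 := by linarith
    exact (mul_eq_zero.1 this).resolve_left (sub_ne_zero.2 (hlam.ne hij))
  have hDd : D = Matrix.diagonal fun i => D i i := by
    ext i j
    by_cases h : i = j
    · subst h; simp
    · simp [h, hoff i j h]
  -- As `D` is diagonal, the zero diagonal of `X = U * D * Uᵀ` is a linear system for the diagonal
  -- of `D`, with matrix `U ⊙ U`.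
  have hz : (U ⊙ U) *ᵥ (fun i => D i i) = 0 := by
    ext i
    have h := congrFun (congrFun hdiag i) i
    rw [hX, hDd] at h
    simp only [Matrix.hadamard_apply, Matrix.one_apply_eq, one_mul, Matrix.zero_apply] at h
    rw [Matrix.mul_apply] at h
    simp only [Matrix.mul_diagonal, Matrix.transpose_apply] at h
    rw [Pi.zero_apply, ← h, Matrix.mulVec, dotProduct]
    exact Finset.sum_congr rfl fun k _ => by simp only [Matrix.hadamard_apply]; ring
  have hD0 := Matrix.eq_zero_of_mulVec_eq_zero hdet hz
  rw [hX, hDd, hD0]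
  simp

lemma conj_mem_isospectral {m : ℕ} {lam : Fin m → ℝ} {U : Matrix (Fin m) (Fin m) ℝ}
    (hU : U ∈ Matrix.orthogonalGroup (Fin m) ℝ) :
    U * Matrix.diagonal lam * Uᵀ ∈ isospectral lam := by
  have h1 : Uᵀ * U = 1 := (Matrix.mem_orthogonalGroup_iff' _ _).1 hU
  refine ⟨by simp [Matrix.IsSymm, Matrix.mul_assoc], ?_⟩
  rw [Matrix.mul_assoc, Matrix.charpoly_mul_comm, Matrix.mul_assoc, h1, Matrix.mul_one,
    Matrix.charpoly_diagonal]
  have h := Polynomial.roots_multiset_prod_X_sub_C (Finset.univ.val.map lam)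
  rwa [Multiset.map_map] at h

/-! ### Matrices patterned on a path. -/

/-- If the off-diagonal pattern of `A` is the path `q 0, …, q n`, and `v` vanishes on the path
except at its end `q n`, then `U *ᵥ v` does not vanish at `q 0`. -/
lemma mulVec_ne_zero_of_path {m : ℕ} {lam : Fin m → ℝ} (hlam : Function.Injective lam)
    {A U : Matrix (Fin m) (Fin m) ℝ}
    (hU : U ∈ Matrix.orthogonalGroup (Fin m) ℝ) (hA : A = U * Matrix.diagonal lam * Uᵀ)
    (hUd : ∀ l, U l l ≠ 0) {n : ℕ} {q : ℕ → Fin m}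
    (hq : ∀ a ≤ n, ∀ b ≤ n, q a = q b → a = b)
    (hpath : ∀ j l, j ≠ l → (A j l ≠ 0 ↔
      ∃ a < n, (j = q a ∧ l = q (a + 1)) ∨ (l = q a ∧ j = q (a + 1))))
    {v : Fin m → ℝ} (hv : ∀ a < n, v (q a) = 0) (hvn : v (q n) ≠ 0) :
    (U *ᵥ v) (q 0) ≠ 0 := by
  have h1 : Uᵀ * U = 1 := (Matrix.mem_orthogonalGroup_iff' _ _).1 hU
  have h2 : U * Uᵀ = 1 := (Matrix.mem_orthogonalGroup_iff _ _).1 hU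
  have hAU : A * U = U * Matrix.diagonal lam := by
    rw [hA, Matrix.mul_assoc, h1, Matrix.mul_one]
  have hrow : ∀ i k, ∑ l, A i l * U l k = U i k * lam k := fun i k => by
    rw [← Matrix.mul_apply, hAU, Matrix.mul_diagonal]
  -- A vertex `l` off the path is isolated. Since `U l l ≠ 0`, this forces `A l l = lam l`, so row
  -- `l` of `U` lives at `l`; orthogonality of rows then clears column `l`.
  have hout : ∀ l, (∀ a ≤ n, l ≠ q a) → ∀ j, j ≠ l → U j l = 0 := by
    intro l hl
    have hAl : ∀ j, j ≠ l → A l j = 0 := by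
      intro j hj
      by_contra h
      obtain ⟨a, ha, ⟨h, -⟩ | ⟨-, h⟩⟩ := (hpath l j hj.symm).1 h
      · exact hl a ha.le h
      · exact hl (a + 1) ha h
    have hr : ∀ k, A l l * U l k = U l k * lam k := fun k => by
      rw [← hrow l k, Finset.sum_eq_single l (fun j _ hj => by rw [hAl j hj, zero_mul]) (by simp)]
    have hll : A l l = lam l :=
      mul_right_cancel₀ (hUd l) ((hr l).trans (mul_comm _ _))
    have hzero : ∀ k, k ≠ l → U l k = 0 := by
      intro k hk
      have h := hr k
      rw [hll] at h
      have : (lam l - lam k) * U l k = 0 := by linarith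
      exact (mul_eq_zero.1 this).resolve_left (sub_ne_zero.2 (hlam.ne hk.symm))
    intro j hj
    have h := congrFun (congrFun h2 j) l
    rw [Matrix.mul_apply, Matrix.one_apply_ne hj, Finset.sum_eq_single l
      (fun k _ hk => by rw [Matrix.transpose_apply, hzero k hk, mul_zero]) (by simp)] at h
    exact (mul_eq_zero.1 h).resolve_right (hUd l)
  have hend : U (q 0) (q n) ≠ 0 := by
    intro h0
    -- The three-term recurrence for column `q n`, an eigenvector of `A`, spreads a zero at `q 0`
    -- along the path up to the nonzero entry `U (q n) (q n)`.
    have key : ∀ a ≤ n, U (q a) (q n) = 0 := by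
      intro a
      induction a using Nat.strong_induction_on with
      | _ a ih =>
        intro ha
        rcases a with _ | a
        · exact h0
        have hne : q a ≠ q (a + 1) := fun h => by
          have := hq a (by omega) (a + 1) ha h; omega
        have h := hrow (q a) (q n)
        rw [ih a (by omega) (by omega), zero_mul, Finset.sum_eq_single (q (a + 1)) ?_ (by simp)]
          at h
        · exact (mul_eq_zero.1 h).resolve_left
            ((hpath _ _ hne).2 ⟨a, by omega, Or.inl ⟨rfl, rfl⟩⟩)
        · intro l _ hl
          by_cases hla : l = q a
          · rw [hla, ih a (by omega) (by omega), mul_zero]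
          by_contra hc
          obtain ⟨b, hb, ⟨hb1, hb2⟩ | ⟨hb1, hb2⟩⟩ :=
            (hpath (q a) l (Ne.symm hla)).1 (left_ne_zero_of_mul hc)
          · have := hq a (by omega) b hb.le hb1
            subst this
            exact hl hb2
          · have := hq a (by omega) (b + 1) hb hb2
            refine right_ne_zero_of_mul hc ?_
            rw [hb1]
            exact ih b (by omega) hb.le
    exact hUd _ (key n le_rfl)
  rw [Matrix.mulVec, dotProduct, Finset.sum_eq_single (q n) ?_ (by simp)]
  · exact mul_ne_zero hend hvn
  · intro l _ hl
    by_cases h : ∃ a ≤ n, l = q a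
    · obtain ⟨a, ha, rfl⟩ := h
      have : a ≠ n := fun e => hl (by rw [e])
      rw [hv a (by omega), mul_zero]
    · push Not at h
      rw [hout l h (q 0) (h 0 (Nat.zero_le n)).symm, zero_mul]

/-- In a connected graph every vertex is joined by a path to the support of a nonzero vector so
that only the last vertex lies in the support. -/
lemma exists_path_to_support {m : ℕ} {G : SimpleGraph (Fin m)} (hG : G.Connected)
    {v : Fin m → ℝ} (hv : v ≠ 0) (i : Fin m) :
    ∃ (n : ℕ) (q : ℕ → Fin m), q 0 = i ∧ (∀ a ≤ n, ∀ b ≤ n, q a = q b → a = b) ∧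
      (∀ a < n, G.Adj (q a) (q (a + 1))) ∧ (∀ a < n, v (q a) = 0) ∧ v (q n) ≠ 0 := by
  obtain ⟨k0, hk0⟩ := Function.ne_iff.1 hv
  -- Take a support vertex nearest to `i`: an earlier support vertex on a shortest path to it would
  -- be nearer still.
  obtain ⟨k, hk, hmin⟩ := Finset.exists_min_image (Finset.univ.filter fun k => v k ≠ 0) (G.dist i)
    ⟨k0, by simpa using hk0⟩
  obtain ⟨p, hp, hlen⟩ := hG.exists_path_of_dist i k
  refine ⟨p.length, p.getVert, by simp, fun a ha b hb h => hp.getVert_injOn ha hb h,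
    fun a ha => p.adj_getVert_succ ha, fun a ha => ?_, by simpa using hk⟩
  by_contra hc
  have h1 := hmin (p.getVert a) (by simpa using hc)
  have h2 := (SimpleGraph.dist_le (p.take a)).trans (by simp : _ ≤ a)
  omega

/-! ### Perturbations along the edges of `G`. -/

/-- The linear projection of matrices onto those supported on the edges of `G`. -/
noncomputable def edgeProj {m : ℕ} (G : SimpleGraph (Fin m)) :
    Matrix (Fin m) (Fin m) ℝ →L[ℝ] Matrix (Fin m) (Fin m) ℝ :=
  open scoped Classical in
  LinearMap.toContinuousLinearMap
    { toFun := fun K => Matrix.of fun i j => if G.Adj i j then K i j else 0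
      map_add' := fun K L => by ext i j; by_cases h : G.Adj i j <;> simp [h]
      map_smul' := fun c K => by ext i j; by_cases h : G.Adj i j <;> simp [h] }

open scoped Classical in
lemma edgeProj_apply {m : ℕ} (G : SimpleGraph (Fin m)) (K : Matrix (Fin m) (Fin m) ℝ)
    (i j : Fin m) : edgeProj G K i j = if G.Adj i j then K i j else 0 := rfl

/-- The `(i, j)` entry as a continuous linear functional. -/
noncomputable def entryCLM {m : ℕ} (i j : Fin m) : Matrix (Fin m) (Fin m) ℝ →L[ℝ] ℝ :=
  LinearMap.toContinuousLinearMap (Matrix.entryLinearMap ℝ ℝ i j)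

lemma entryCLM_apply {m : ℕ} (i j : Fin m) (K : Matrix (Fin m) (Fin m) ℝ) :
    entryCLM i j K = K i j := rfl

/-- Evaluation of `K *ᵥ v` at `i` as a continuous linear functional of `K`. -/
noncomputable def mulVecCLM {m : ℕ} (v : Fin m → ℝ) (i : Fin m) :
    Matrix (Fin m) (Fin m) ℝ →L[ℝ] ℝ :=
  ∑ j, v j • entryCLM i j

lemma mulVecCLM_apply {m : ℕ} (v : Fin m → ℝ) (i : Fin m) (K : Matrix (Fin m) (Fin m) ℝ) :
    mulVecCLM v i K = (K *ᵥ v) i := by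
  simp [mulVecCLM, Matrix.mulVec, dotProduct, entryCLM_apply, mul_comm]

/-- A germ at 0 can be shown nonzero along a single punctured line `s • W`. -/
lemma frequently_smul_nhds_zero {E : Type*} [NormedAddCommGroup E] [NormedSpace ℝ E] (W : E)
    {P : E → Prop} (h : ∀ᶠ x in 𝓝 (0 : E), ∀ s : ℝ, s ≠ 0 → x = s • W → P x) :
    ∃ᶠ x in 𝓝 (0 : E), P x := by
  have ht : Tendsto (fun s : ℝ => s • W) (𝓝[≠] 0) (𝓝 0) := by
    have : Tendsto (fun s : ℝ => s • W) (𝓝 0) (𝓝 ((0 : ℝ) • W)) :=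
      (continuous_id.smul continuous_const).tendsto 0
    rw [zero_smul] at this
    exact this.mono_left nhdsWithin_le_nhds
  refine ht.frequently (Eventually.frequently ?_)
  filter_upwards [ht.eventually h, self_mem_nhdsWithin] with s hs hs0
  exact hs s hs0 rfl

lemma conj_apply_off_diag {m : ℕ} {lam : Fin m → ℝ} {U T : Matrix (Fin m) (Fin m) ℝ}
    (hT : T.IsSymm) (h : ∀ i j, i < j → (U * Matrix.diagonal lam * Uᵀ) i j = T i j)
    {i j : Fin m} (hij : i ≠ j) : (U * Matrix.diagonal lam * Uᵀ) i j = T i j := by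
  rcases lt_or_gt_of_ne hij with hlt | hlt
  · exact h i j hlt
  · have hs : (U * Matrix.diagonal lam * Uᵀ).IsSymm := by simp [Matrix.IsSymm, Matrix.mul_assoc]
    rw [← hs.apply, h j i hlt, hT.apply]

lemma frequently_mulVec_ne_zero {m : ℕ} {lam : Fin m → ℝ} (hlam : Function.Injective lam)
    {G : SimpleGraph (Fin m)} (hG : G.Connected)
    {U : Matrix (Fin m) (Fin m) ℝ → Matrix (Fin m) (Fin m) ℝ}
    (hU : ∀ T, U T ∈ Matrix.orthogonalGroup (Fin m) ℝ)
    (hUd : ∀ᶠ T in 𝓝 0, ∀ l, U T l l ≠ 0)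
    (hUT : ∀ᶠ T in 𝓝 0, ∀ i j, i < j → (U T * Matrix.diagonal lam * (U T)ᵀ) i j = T i j)
    {v : Fin m → ℝ} (hv : v ≠ 0) (i : Fin m) :
    ∃ᶠ T in 𝓝 0, (U (edgeProj G T) *ᵥ v) i ≠ 0 := by
  classical
  obtain ⟨n, q, rfl, hq, hadj, hv0, hvn⟩ := exists_path_to_support hG hv i
  -- The adjacency matrix of the path. Other edges of `G` may get entry zero, since only a nonzero
  -- germ is needed here.
  let W : Matrix (Fin m) (Fin m) ℝ := Matrix.of fun j l =>
    if ∃ a < n, (j = q a ∧ l = q (a + 1)) ∨ (l = q a ∧ j = q (a + 1)) then 1 else 0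
  have hW : ∀ j l, W j l =
      if ∃ a < n, (j = q a ∧ l = q (a + 1)) ∨ (l = q a ∧ j = q (a + 1)) then 1 else 0 :=
    fun _ _ => rfl
  have hWs : W.IsSymm := by
    ext j l
    simp only [Matrix.transpose_apply, hW]
    congr 1
    simp only [or_comm]
  have hWG : edgeProj G W = W := by
    ext j l
    rw [edgeProj_apply]
    split_ifs with h
    · rfl
    · rw [hW, if_neg]
      rintro ⟨a, ha, ⟨rfl, rfl⟩ | ⟨rfl, rfl⟩⟩
      · exact h (hadj a ha)
      · exact h (hadj a ha).symm
  refine frequently_smul_nhds_zero W ?_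
  filter_upwards [hUd, hUT] with T hd hT s hs hTs
  have hproj : edgeProj G T = T := by rw [hTs, map_smul, hWG]
  rw [hproj]
  refine mulVec_ne_zero_of_path hlam (hU T) rfl hd hq (fun j l hjl => ?_) hv0 hvn
  have hTsymm : T.IsSymm := hTs ▸ hWs.smul s
  rw [conj_apply_off_diag hTsymm hT hjl, hTs, Matrix.smul_apply, hW]
  split_ifs with h
  · exact iff_of_true (by simpa using hs) h
  · exact iff_of_false (by simp) h

/-- Every connected graph carries a matrix with prescribed simple spectrum `lam` and a
diagonalizing orthogonal matrix `U`,
whose entrywise square is nonsingular, such that `U *ᵥ v` is nowhere zero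
for each `v` in a given finite set of nonzero vectors. -/
theorem exists_realisation (m : ℕ) (lam : Fin m → ℝ)
    (hlam : Function.Injective lam)
    (G : SimpleGraph (Fin m)) (hG : G.Connected)
    (Y : Set (Fin m → ℝ)) (hYfin : Y.Finite) (hY0 : Y ⊆ {0}ᶜ) :
    ∃ U ∈ Matrix.orthogonalGroup (Fin m) ℝ, (U ⊙ U).det ≠ 0 ∧
      U * Matrix.diagonal lam * Uᵀ ∈ S G ∧ ∀ v ∈ Y, NowhereZero (U *ᵥ v) := by
  classical
  obtain ⟨U, hUan, hU0, hU, hUT⟩ := exists_analyticAt_orthogonal hlam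
  have hentry : ∀ i j, ContinuousAt (fun T => U T i j) 0 := fun i j =>
    (entryCLM i j).continuous.continuousAt.comp hUan.continuousAt
  have hUd : ∀ᶠ T in 𝓝 0, ∀ l, U T l l ≠ 0 := by
    refine eventually_all.2 fun l => (hentry l l).eventually_ne ?_
    simp [hU0]
  have hdet : ∀ᶠ T in 𝓝 0, (U T ⊙ U T).det ≠ 0 := by
    have hc : ContinuousAt (fun T => U T ⊙ U T) 0 :=
      continuousAt_pi.2 fun i => continuousAt_pi.2 fun j => (hentry i j).mul (hentry i j)
    have hcd : ContinuousAt (fun T => (U T ⊙ U T).det) 0 :=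
      (continuous_id.matrix_det).continuousAt.comp hc
    refine hcd.eventually_ne ?_
    simp [hU0, Matrix.hadamard_one]
  have hproj : Tendsto (edgeProj G) (𝓝 0) (𝓝 0) := by
    simpa using (edgeProj G).continuous.tendsto 0
  have hf1 : ∃ᶠ T : Matrix (Fin m) (Fin m) ℝ in 𝓝 0,
      ∏ x ∈ Finset.univ.filter (fun x : Fin m × Fin m => G.Adj x.1 x.2), T x.1 x.2 ≠ 0 := by
    refine frequently_prod_ne_zero (f := fun (x : Fin m × Fin m) T => entryCLM x.1 x.2 T) _
      (fun x _ => (entryCLM x.1 x.2).analyticAt 0) fun x _ => ?_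
    refine frequently_smul_nhds_zero (Matrix.of fun _ _ => 1) (Eventually.of_forall ?_)
    rintro _ s hs rfl
    simpa [entryCLM_apply] using hs
  have han2 : ∀ x : (Fin m → ℝ) × Fin m,
      AnalyticAt ℝ (fun T => mulVecCLM x.1 x.2 (U (edgeProj G T))) 0 := fun x =>
    ((mulVecCLM x.1 x.2).analyticAt _).comp
      (AnalyticAt.comp (by simpa using hUan) ((edgeProj G).analyticAt 0))
  have hf2 : ∃ᶠ T : Matrix (Fin m) (Fin m) ℝ in 𝓝 0,
      ∏ x ∈ hYfin.toFinset ×ˢ Finset.univ, mulVecCLM x.1 x.2 (U (edgeProj G T)) ≠ 0 := by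
    refine frequently_prod_ne_zero
      (f := fun (x : (Fin m → ℝ) × Fin m) T => mulVecCLM x.1 x.2 (U (edgeProj G T))) _
      (fun x _ => han2 x) fun x hx => ?_
    simp only [mulVecCLM_apply]
    exact frequently_mulVec_ne_zero hlam hG hU hUd hUT
      (hY0 (hYfin.mem_toFinset.1 (Finset.mem_product.1 hx).1)) x.2
  have hf := frequently_mul_ne_zero
    (Finset.analyticAt_fun_prod _
      fun (x : Fin m × Fin m) _ => (entryCLM x.1 x.2).analyticAt 0)
    (Finset.analyticAt_fun_prod _ fun x _ => han2 x) hf1 hf2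
  obtain ⟨T, hT, hTd, hTU⟩ :=
    (hf.and_eventually ((hproj.eventually hdet).and (hproj.eventually hUT))).exists
  have hT1 := Finset.prod_ne_zero_iff.1 (left_ne_zero_of_mul hT)
  have hT2 := Finset.prod_ne_zero_iff.1 (right_ne_zero_of_mul hT)
  have hs : (U (edgeProj G T) * Matrix.diagonal lam * (U (edgeProj G T))ᵀ).IsSymm := by
    simp [Matrix.IsSymm, Matrix.mul_assoc]
  -- `T` need not be symmetric: only its entries above the diagonal are realised, and symmetry of
  -- the conjugate gives the others.
  have hlt : ∀ i j, i < j →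
      ((U (edgeProj G T) * Matrix.diagonal lam * (U (edgeProj G T))ᵀ) i j ≠ 0 ↔ G.Adj i j) := by
    intro i j hij
    rw [hTU i j hij, edgeProj_apply]
    split_ifs with h
    · exact iff_of_true (hT1 (i, j) (by simpa using h)) h
    · exact iff_of_false (by simp) h
  refine ⟨U (edgeProj G T), hU _, hTd, ⟨hs, fun i j hij => ?_⟩, fun v hv i => ?_⟩
  · rcases lt_or_gt_of_ne hij with h | h
    · exact hlt i j h
    · rw [← hs.apply, hlt j i h, G.adj_comm]
  · rw [← mulVecCLM_apply]
    exact hT2 (v, i) (by simpa using hv)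

end GenericRealisability

theorem mainTheorem2 (m : ℕ) (lam : Fin m → ℝ) (hlam : StrictMono lam)
    (G : SimpleGraph (Fin m)) (hG : G.Connected)
    (Y : Set (Fin m → ℝ)) (hYfin : Y.Finite) (hY0 : Y ⊆ {0}ᶜ) :
    ∃ A ∈ GenericRealisability.S G ∩ GenericRealisability.isospectral lam,
      GenericRealisability.SSP A ∧
      ∃ U ∈ Matrix.orthogonalGroup (Fin m) ℝ,
        Uᵀ * A * U = Matrix.diagonal lam ∧
        ∀ v ∈ Y, GenericRealisability.NowhereZero (U *ᵥ v) := by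
  obtain ⟨U, hU, hdet, hS, hv⟩ :=
    GenericRealisability.exists_realisation m lam hlam.injective G hG Y hYfin hY0
  have h1 : Uᵀ * U = 1 := (Matrix.mem_orthogonalGroup_iff' _ _).1 hU
  refine ⟨U * Matrix.diagonal lam * Uᵀ, ⟨hS, GenericRealisability.conj_mem_isospectral hU⟩,
    GenericRealisability.SSP_of_det_sq_ne_zero hlam.injective hU hdet, U, hU, ?_, hv⟩
  rw [Matrix.mul_assoc, Matrix.mul_assoc, h1, Matrix.mul_one, ← Matrix.mul_assoc, h1,
    Matrix.one_mul]
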